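/- For $x>0$ and $q>0$ let $\Gamma_q$ be the $q$-gamma function, $$\Gamma_q(x)=(1-q)^{1-x}\prod_{n=0}^\infty\frac{1-q^{n+1}}{1-q^{n+x}}\quad(0<q<1),\qquad \Gamma_q(x)=(q-1)^{1-x}q^{x(x-1)/2}\prod_{n=0}^\infty\frac{1-q^{-(n+1)}}{1-q^{-(n+x)}}\quad(q>1),$$ $\Gamma_1=\Gamma$, and let $\psi_q(x)=\Gamma_q'(x)/\Gamma_q(x)$ be the $q$-digamma function, with derivative $\psi_q'$ in $x$. Let $q>0$. Then $\psi_q(1)<0$ and $$-\frac{\psi_q'(1)}{\psi_q(1)}\ge 2,$$ and for every $a\in\mathbb R$, $$\psi_q'(x)+a\,\psi_q(x)\ge 0\ \text{ for all } x\ge 1\quad\Longleftrightarrow\quad 0\le a\le-\frac{\psi_q'(1)}{\psi_q(1)}.$$ In particular, $\psi_q'(x)+\psi_q(x)\ge0$ and $\psi_q'(x)+2\psi_q(x)\ge 0$ for all $x\ge 1$. The following hold for the weighted expression $h(x,a,q)=x\psi_q'(x)+a\psi_q(x)$ and every $a\in\mathbb R$. If $0\le a\le-\psi_q'(1)/\psi_q(1)$,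 then $h(x,a,q)\ge0$ for all $x\ge1$ (for $a=2$ this is Alzer's inequality $x\psi_q'(x)+2\psi_q(x)\ge0$). Conversely, if $h(x,a,q)\ge 0$ for all $x\ge1$, then $a\le-\psi_q'(1)/\psi_q(1)$, and if moreover $q\le 1$, then also $a\ge 0$. Thus for $0<q\le1$ one has $h(x,a,q)\ge 0$ for all $x\ge1$ if and only if $0\le a\le-\psi_q'(1)/\psi_q(1)$. -/

import Mathlib

/-- The `q`-gamma function `Γ_q(x)` (for `q > 0` and `x > 0`), equal to Euler's `Γ` for `q = 1`. -/
noncomputable def qGamma (q x : ℝ) : ℝ :=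
  if q < 1 then
    (1 - q) ^ (1 - x) * ∏' n : ℕ, (1 - q ^ ((n : ℝ) + 1)) / (1 - q ^ ((n : ℝ) + x))
  else if q = 1 then
    Real.Gamma x
  else
    (q - 1) ^ (1 - x) * q ^ (x * (x - 1) / 2) *
      ∏' n : ℕ, (1 - q ^ (-((n : ℝ) + 1))) / (1 - q ^ (-((n : ℝ) + x)))

/-- The `q`-digamma function `ψ_q(x) = Γ_q'(x) / Γ_q(x)`. -/
noncomputable def qDigamma (q x : ℝ) : ℝ :=
  deriv (qGamma q) x / qGamma q x

/-!
The idea is to differentiate the product for `Γ_q` termwise and to read every inequality off the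
individual terms. Let `0 < q ≤ 1`, `L = -log q`, and let `r` be the derivative of `log [x]`, that is
`r x = L q ^ x / (1 - q ^ x)`, or `1 / x` if `q = 1`. It satisfies `r' = -r (r + L)`, so that
`ψ_q(x) = ∑ (κ n - r (n + x))` and `ψ_q'(x) = ∑ (r (r + L)) (n + x)`, where `κ n` is the increment of
`log [x]` from `n + 1` to `n + 2`. The case `q = 1` and the case `q < 1` are treated together through
the structure `IsQLog`.

Let `c = -ψ_q'(1) / ψ_q(1)` and `M = 2 r(1) + L = L coth (L / 2) ≥ 2`.

* `ψ_q'(1) + M ψ_q(1) ≥ 0` holds term by term (`IsQLog.trigamma_add_digamma_one_nonneg`, with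
  `log_key_inequality` and `qLogSlope_key_inequality`); the latter reduces to
  `log (1 + s) ≥ s - s² / 2` and `L ≤ sinh L`. Hence `c ≥ M ≥ 2`.
* For `c ≥ M` the function `ψ_q' + c ψ_q` is increasing on `[1, ∞)`, again term by term, because
  `t ↦ t (t + L - c)` is decreasing on `[0, r(1)]` (`IsQLog.monotoneOn_trigamma_add`). It vanishes
  at `1`, so it is nonnegative on `[1, ∞)`. As `ψ_q' ≥ 0`, this gives the inequality for
  `0 ≤ a ≤ c`, and then the weighted one, since `x ψ_q' ≥ ψ_q'` (`ratio_characterization`).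
* The point `x = 1` forces `a ≤ c`, and the behaviour at infinity forces `a ≥ 0`
  (`exists_weighted_neg_of_lt_one`, `exists_weighted_neg_one`).

For `q > 1` and `p = 1 / q` one has `ψ_q(x) = (x - 3/2) log q + ψ_p(x)`. The bound `c ≥ 2` follows from
the one for `p`, and the linear term together with `ψ_p' ≤ π² / 6 < 2` makes `ψ_q' + c ψ_q` increasing
for every `c ≥ 2` (`monotoneOn_of_one_lt`).
-/

/-! ### Logarithms of `q`-numbers -/

/-- `IsQLog L ℓ r` collects what the argument uses about the logarithm `ℓ x` of the `q`-number `[x]`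
(up to an additive constant), where `L = -log q` and `0 < q ≤ 1`: its derivative `r` is positive and
solves the Riccati equation `r' = -r (r + L)`, and the sums of `r (r + L)` over the shifts `n + x`
converge. For `q = 1` this is `ℓ = log`, `r x = 1 / x`, `L = 0`. Lemma names refer to `r` as the slope
and to `r (r + L) = -ℓ''` as the curvature. -/
structure IsQLog (L : ℝ) (ℓ r : ℝ → ℝ) : Prop where
  nonneg : 0 ≤ L
  hasDerivAt_log : ∀ x, 0 < x → HasDerivAt ℓ (r x) x
  hasDerivAt_slope : ∀ x, 0 < x → HasDerivAt r (-(r x * (r x + L))) x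
  pos : ∀ x, 0 < x → 0 < r x
  summable : ∀ x, 0 < x → Summable fun n : ℕ => r (n + x) * (r (n + x) + L)

namespace IsQLog

variable {L : ℝ} {ℓ r : ℝ → ℝ}

theorem slope_strictAntiOn (h : IsQLog L ℓ r) : StrictAntiOn r (Set.Ioi 0) := by
  refine strictAntiOn_of_deriv_neg (convex_Ioi 0)
    (fun x hx => (h.hasDerivAt_slope x hx).continuousAt.continuousWithinAt) fun x hx => ?_
  rw [interior_Ioi] at hx
  rw [(h.hasDerivAt_slope x hx).deriv]
  have := h.pos x hx
  have := h.nonneg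
  exact neg_lt_zero.2 (by positivity)

theorem slope_le (h : IsQLog L ℓ r) {x y : ℝ} (hx : 0 < x) (hxy : x ≤ y) : r y ≤ r x :=
  h.slope_strictAntiOn.antitoneOn hx (hx.trans_le hxy) hxy

theorem curvature_nonneg (h : IsQLog L ℓ r) {x : ℝ} (hx : 0 < x) : 0 ≤ r x * (r x + L) := by
  have := h.pos x hx
  have := h.nonneg
  positivity

theorem curvature_le (h : IsQLog L ℓ r) {x y : ℝ} (hx : 0 < x) (hxy : x ≤ y) :
    r y * (r y + L) ≤ r x * (r x + L) := by
  have h1 := h.slope_le hx hxy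
  have h2 := h.pos y (hx.trans_le hxy)
  have := h.nonneg
  have := h.pos x hx
  gcongr

theorem abs_slope_sub_le (h : IsQLog L ℓ r) {ε x y : ℝ} (hε : 0 < ε) (hx : ε ≤ x) (hy : ε ≤ y) :
    |r y - r x| ≤ r ε * (r ε + L) * |y - x| := by
  refine (convex_Ici ε).norm_image_sub_le_of_norm_hasDerivWithin_le
    (fun z hz => (h.hasDerivAt_slope z (hε.trans_le hz)).hasDerivWithinAt) (fun z hz => ?_) hx hy
  rw [norm_neg, Real.norm_of_nonneg (h.curvature_nonneg (hε.trans_le hz))]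
  exact h.curvature_le hε hz

theorem exists_increment_eq (h : IsQLog L ℓ r) {x : ℝ} (hx : 0 < x) :
    ∃ ξ ∈ Set.Ioo x (x + 1), ℓ (x + 1) - ℓ x = r ξ := by
  obtain ⟨ξ, hξ, e⟩ := exists_hasDerivAt_eq_slope ℓ r (lt_add_one x)
    (fun z hz => (h.hasDerivAt_log z (hx.trans_le hz.1)).continuousAt.continuousWithinAt)
    (fun z hz => h.hasDerivAt_log z (hx.trans hz.1))
  exact ⟨ξ, hξ, by simp [e]⟩

theorem increment_lt (h : IsQLog L ℓ r) {x : ℝ} (hx : 0 < x) : ℓ (x + 1) - ℓ x < r x := by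
  obtain ⟨ξ, hξ, e⟩ := h.exists_increment_eq hx
  exact e ▸ h.slope_strictAntiOn hx (hx.trans hξ.1) hξ.1

theorem abs_increment_sub_le (h : IsQLog L ℓ r) {x : ℝ} (hx : 0 < x) :
    |ℓ (x + 1) - ℓ x - r x| ≤ r x * (r x + L) := by
  obtain ⟨ξ, hξ, e⟩ := h.exists_increment_eq hx
  rw [e]
  refine (h.abs_slope_sub_le hx le_rfl hξ.1.le).trans ?_
  refine mul_le_of_le_one_right (h.curvature_nonneg hx) ?_
  rw [abs_of_nonneg (by linarith [hξ.1])]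
  linarith [hξ.2]

end IsQLog

/-! ### The series for `log Γ_q` and its derivatives -/

/-- The series for `log Γ_q x` in terms of `ℓ x = log [x]`. The multiples of `x - 1` make it converge
also for `q = 1`, and adding a constant to `ℓ` does not change it. -/
noncomputable def logGammaSeries (ℓ : ℝ → ℝ) (x : ℝ) : ℝ :=
  ∑' n : ℕ, (ℓ (n + 1) - ℓ (n + x) + (x - 1) * (ℓ (n + 1 + 1) - ℓ (n + 1)))

/-- The termwise derivative of `logGammaSeries`. -/
noncomputable def digammaSeries (ℓ r : ℝ → ℝ) (x : ℝ) : ℝ :=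
  ∑' n : ℕ, (ℓ (n + 1 + 1) - ℓ (n + 1) - r (n + x))

/-- The termwise derivative of `digammaSeries` when `r' = -r (r + L)`. -/
noncomputable def trigammaSeries (L : ℝ) (r : ℝ → ℝ) (x : ℝ) : ℝ :=
  ∑' n : ℕ, r (n + x) * (r (n + x) + L)

namespace IsQLog

variable {L : ℝ} {ℓ r : ℝ → ℝ}

theorem summable_digamma_one (h : IsQLog L ℓ r) :
    Summable fun n : ℕ => ℓ (n + 1 + 1) - ℓ (n + 1) - r (n + 1) :=
  .of_norm_bounded (h.summable 1 one_pos) fun n => h.abs_increment_sub_le (by positivity)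

theorem hasDerivAt_digamma_term (h : IsQLog L ℓ r) (n : ℕ) {x : ℝ} (hx : 0 < x) :
    HasDerivAt (fun x => ℓ (n + 1 + 1) - ℓ (n + 1) - r (n + x)) (r (n + x) * (r (n + x) + L)) x := by
  have := ((h.hasDerivAt_slope (n + x) (by positivity)).comp_const_add (n : ℝ) x).const_sub
    (ℓ (n + 1 + 1) - ℓ (n + 1))
  simpa using this

theorem norm_curvature_le (h : IsQLog L ℓ r) {ε x : ℝ} (hε : 0 < ε) (hx : ε < x) (n : ℕ) :
    ‖r (n + x) * (r (n + x) + L)‖ ≤ r (n + ε) * (r (n + ε) + L) := by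
  have := hε.trans hx
  rw [Real.norm_of_nonneg (h.curvature_nonneg (by positivity))]
  exact h.curvature_le (by positivity) (by linarith)

theorem summable_digamma (h : IsQLog L ℓ r) {x : ℝ} (hx : 0 < x) :
    Summable fun n : ℕ => ℓ (n + 1 + 1) - ℓ (n + 1) - r (n + x) := by
  obtain ⟨ε, hε, hε'⟩ := exists_between (lt_min hx one_pos)
  rw [lt_min_iff] at hε'
  exact summable_of_summable_hasDerivAt_of_isPreconnected (t := Set.Ioi ε) (h.summable ε hε) isOpen_Ioi
    isPreconnected_Ioi (fun n y hy => h.hasDerivAt_digamma_term n (hε.trans hy))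
    (fun n y hy => h.norm_curvature_le hε hy n) hε'.2 h.summable_digamma_one hε'.1

theorem hasDerivAt_digammaSeries (h : IsQLog L ℓ r) {x : ℝ} (hx : 0 < x) :
    HasDerivAt (digammaSeries ℓ r) (trigammaSeries L r x) x := by
  obtain ⟨ε, hε, hε'⟩ := exists_between (lt_min hx one_pos)
  rw [lt_min_iff] at hε'
  exact hasDerivAt_tsum_of_isPreconnected (t := Set.Ioi ε) (h.summable ε hε) isOpen_Ioi
    isPreconnected_Ioi (fun n y hy => h.hasDerivAt_digamma_term n (hε.trans hy))
    (fun n y hy => h.norm_curvature_le hε hy n) hε'.2 h.summable_digamma_one hε'.1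

theorem hasDerivAt_logGamma_term (h : IsQLog L ℓ r) (n : ℕ) {x : ℝ} (hx : 0 < x) :
    HasDerivAt (fun x => ℓ (n + 1) - ℓ (n + x) + (x - 1) * (ℓ (n + 1 + 1) - ℓ (n + 1)))
      (ℓ (n + 1 + 1) - ℓ (n + 1) - r (n + x)) x := by
  have h1 := ((h.hasDerivAt_log (n + x) (by positivity)).comp_const_add (n : ℝ) x).const_sub
    (ℓ (n + 1))
  have h2 := ((hasDerivAt_id x).sub_const 1).mul_const (ℓ (n + 1 + 1) - ℓ (n + 1))
  convert! h1.add h2 using 1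
  ring

/-- On a bounded interval `(ε, R)` around `1` the derivatives of the terms of `logGammaSeries` are
compared with their values at `1`, which are summable. -/
theorem norm_digamma_term_le (h : IsQLog L ℓ r) {ε R x : ℝ} (hε : 0 < ε) (hε1 : ε < 1) (hR : 1 < R)
    (hx : x ∈ Set.Ioo ε R) (n : ℕ) :
    ‖ℓ (n + 1 + 1) - ℓ (n + 1) - r (n + x)‖ ≤
      r (n + 1) * (r (n + 1) + L) + r (n + ε) * (r (n + ε) + L) * R := by
  have h1 : |ℓ (n + 1 + 1) - ℓ (n + 1) - r (n + 1)| ≤ _ :=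
    h.abs_increment_sub_le (x := n + 1) (by positivity)
  have h2 := h.abs_slope_sub_le (ε := n + ε) (x := n + x) (y := n + 1) (by positivity)
    (by linarith [hx.1]) (by linarith)
  have h3 : |(n + 1 : ℝ) - (n + x)| ≤ R := abs_le.2 ⟨by linarith [hx.2], by linarith [hx.1]⟩
  have h4 := mul_le_mul_of_nonneg_left h3 (h.curvature_nonneg (x := n + ε) (by positivity))
  rw [Real.norm_eq_abs]
  calc |ℓ (n + 1 + 1) - ℓ (n + 1) - r (n + x)|
      = |(ℓ (n + 1 + 1) - ℓ (n + 1) - r (n + 1)) + (r (n + 1) - r (n + x))| := by ring_nf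
    _ ≤ _ := (abs_add_le _ _).trans (by linarith)

theorem summable_logGamma (h : IsQLog L ℓ r) {x : ℝ} (hx : 0 < x) :
    Summable fun n : ℕ => ℓ (n + 1) - ℓ (n + x) + (x - 1) * (ℓ (n + 1 + 1) - ℓ (n + 1)) := by
  obtain ⟨ε, hε, hε'⟩ := exists_between (lt_min hx one_pos)
  obtain ⟨R, hR⟩ := exists_gt (max x 1)
  rw [lt_min_iff] at hε'
  rw [max_lt_iff] at hR
  exact summable_of_summable_hasDerivAt_of_isPreconnected (t := Set.Ioo ε R) (y₀ := 1)
    (g := fun (n : ℕ) x => ℓ (n + 1) - ℓ (n + x) + (x - 1) * (ℓ (n + 1 + 1) - ℓ (n + 1)))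
    (g' := fun (n : ℕ) x => ℓ (n + 1 + 1) - ℓ (n + 1) - r (n + x))
    ((h.summable 1 one_pos).add ((h.summable ε hε).mul_right R)) isOpen_Ioo
    isPreconnected_Ioo (fun n y hy => h.hasDerivAt_logGamma_term n (hε.trans hy.1))
    (fun n y hy => h.norm_digamma_term_le hε hε'.2 hR.2 hy n) ⟨hε'.2, hR.2⟩
    (by simp) ⟨hε'.1, hR.1⟩

theorem hasDerivAt_logGammaSeries (h : IsQLog L ℓ r) {x : ℝ} (hx : 0 < x) :
    HasDerivAt (logGammaSeries ℓ) (digammaSeries ℓ r x) x := by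
  obtain ⟨ε, hε, hε'⟩ := exists_between (lt_min hx one_pos)
  obtain ⟨R, hR⟩ := exists_gt (max x 1)
  rw [lt_min_iff] at hε'
  rw [max_lt_iff] at hR
  exact hasDerivAt_tsum_of_isPreconnected (t := Set.Ioo ε R) (y₀ := 1)
    (g := fun (n : ℕ) x => ℓ (n + 1) - ℓ (n + x) + (x - 1) * (ℓ (n + 1 + 1) - ℓ (n + 1)))
    (g' := fun (n : ℕ) x => ℓ (n + 1 + 1) - ℓ (n + 1) - r (n + x))
    ((h.summable 1 one_pos).add ((h.summable ε hε).mul_right R)) isOpen_Ioo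
    isPreconnected_Ioo (fun n y hy => h.hasDerivAt_logGamma_term n (hε.trans hy.1))
    (fun n y hy => h.norm_digamma_term_le hε hε'.2 hR.2 hy n) ⟨hε'.2, hR.2⟩
    (by simp) ⟨hε'.1, hR.1⟩

/-! ### Inequalities for the series -/

theorem digammaSeries_one_neg (h : IsQLog L ℓ r) : digammaSeries ℓ r 1 < 0 := by
  have key : ∀ n : ℕ, ℓ (n + 1 + 1) - ℓ (n + 1) - r (n + 1) < 0 := fun n =>
    sub_neg.2 (h.increment_lt (by positivity))
  exact hasSum_lt (fun n => (key n).le) (key 0) h.summable_digamma_one.hasSum hasSum_zero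

theorem trigammaSeries_nonneg (h : IsQLog L ℓ r) {x : ℝ} (hx : 0 < x) : 0 ≤ trigammaSeries L r x :=
  tsum_nonneg fun n => h.curvature_nonneg (by positivity)

theorem trigammaSeries_le (h : IsQLog L ℓ r) {x y : ℝ} (hx : 0 < x) (hxy : x ≤ y) :
    trigammaSeries L r y ≤ trigammaSeries L r x :=
  (h.summable y (hx.trans_le hxy)).tsum_le_tsum
    (fun n => h.curvature_le (by positivity) (by linarith)) (h.summable x hx)

theorem digammaSeries_monotoneOn (h : IsQLog L ℓ r) : MonotoneOn (digammaSeries ℓ r) (Set.Ioi 0) :=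
  fun x hx y hy hxy => (h.summable_digamma hx).tsum_le_tsum
    (fun n => by
      have hx' : (0 : ℝ) < x := hx
      linarith [h.slope_le (x := n + x) (y := n + y) (by positivity) (by linarith)])
    (h.summable_digamma hy)

/-- The terms of the sum are `c κ + r (r + L - c)` with `κ` constant; on `[1, ∞)` the slope `r` decreases
and stays below `r 1`, and `t ↦ t (t + L - c)` is decreasing on `[0, r 1]`. -/
theorem monotoneOn_trigamma_add (h : IsQLog L ℓ r) {c : ℝ} (hc : 2 * r 1 + L ≤ c) :
    MonotoneOn (fun x => trigammaSeries L r x + c * digammaSeries ℓ r x) (Set.Ici 1) := by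
  intro x hx y hy hxy
  have hx' : (1 : ℝ) ≤ x := hx
  have hx0 : (0 : ℝ) < x := by linarith
  have hy0 : (0 : ℝ) < y := by linarith
  have e : ∀ z, 0 < z → HasSum (fun n : ℕ => r (n + z) * (r (n + z) + L) +
      c * (ℓ (n + 1 + 1) - ℓ (n + 1) - r (n + z)))
      (trigammaSeries L r z + c * digammaSeries ℓ r z) := fun z hz =>
    (h.summable z hz).hasSum.add ((h.summable_digamma hz).hasSum.mul_left c)
  refine hasSum_le (fun n => ?_) (e x hx0) (e y hy0)
  have hn : (0 : ℝ) ≤ n := n.cast_nonneg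
  have h1 := h.slope_le (x := n + x) (y := n + y) (by positivity) (by linarith)
  have h2 := h.slope_le (x := 1) (y := n + x) one_pos (by linarith)
  nlinarith [mul_nonneg (sub_nonneg.2 h1) (show 0 ≤ c - L - r (n + x) - r (n + y) by linarith)]

/-- The inequality `ψ'(1) + M ψ(1) ≥ 0` for `M = 2 r(1) + L` holds term by term. -/
theorem trigamma_add_digamma_one_nonneg (h : IsQLog L ℓ r)
    (hκ : ∀ n : ℕ, 0 ≤ r (n + 1) * (r (n + 1) + L) +
      (2 * r 1 + L) * (ℓ (n + 1 + 1) - ℓ (n + 1) - r (n + 1))) :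
    0 ≤ trigammaSeries L r 1 + (2 * r 1 + L) * digammaSeries ℓ r 1 :=
  ((h.summable 1 one_pos).hasSum.add (h.summable_digamma_one.hasSum.mul_left _)).nonneg hκ

end IsQLog

/-! ### The case `q = 1` -/

theorem sub_sq_div_two_le_log_one_add {s : ℝ} (hs : 0 ≤ s) : s - s ^ 2 / 2 ≤ Real.log (1 + s) := by
  refine le_trans ?_ (Real.le_log_one_add_of_nonneg hs)
  rw [le_div_iff₀ (by positivity)]
  nlinarith [pow_nonneg hs 3]

theorem isQLog_log : IsQLog 0 Real.log (fun x => 1 / x) where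
  nonneg := le_rfl
  hasDerivAt_log x hx := by simpa using Real.hasDerivAt_log hx.ne'
  hasDerivAt_slope x hx := by
    convert! hasDerivAt_inv hx.ne' using 1
    · simp
    · field_simp
      simp
  pos x hx := by positivity
  summable x hx := by
    have h1 : Summable fun n : ℕ => 1 / |(n : ℝ) + x| ^ (2 : ℝ) :=
      Real.summable_one_div_nat_add_rpow x 2 |>.2 one_lt_two
    refine h1.congr fun n => ?_
    rw [abs_of_pos (by positivity), Real.rpow_two, add_zero, sq, one_div_mul_one_div]

theorem log_key_inequality (n : ℕ) : 0 ≤ 1 / ((n : ℝ) + 1) * (1 / ((n : ℝ) + 1) + 0) +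
    (2 * (1 / 1) + 0) * (Real.log (n + 1 + 1) - Real.log (n + 1) - 1 / ((n : ℝ) + 1)) := by
  have hn : (0 : ℝ) < n + 1 := by positivity
  have h := sub_sq_div_two_le_log_one_add (s := 1 / ((n : ℝ) + 1)) (by positivity)
  rw [← Real.log_div (by positivity) hn.ne',
    show ((n : ℝ) + 1 + 1) / (n + 1) = 1 + 1 / ((n : ℝ) + 1) by field_simp]
  linarith

/-- Euler's limit formula for `Γ`, as a series. -/
theorem Gamma_eq_exp_logGammaSeries {x : ℝ} (hx : 0 < x) :
    Real.Gamma x = Real.exp (logGammaSeries Real.log x) := by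
  have h1 := (isQLog_log.summable_logGamma hx).hasSum.tendsto_sum_nat
  have h2 := Real.BohrMollerup.tendsto_log_gamma hx
  have hsum : ∀ N : ℕ, ∑ n ∈ Finset.range N, (Real.log (n + 1) - Real.log (n + x) +
        (x - 1) * (Real.log (n + 1 + 1) - Real.log (n + 1))) =
      Real.BohrMollerup.logGammaSeq x N + (x - 1) * (Real.log (N + 1) - Real.log N) +
        (Real.log (N + x) - Real.log N) := by
    intro N
    have hfac : ∀ N : ℕ, Real.log (N.factorial : ℝ) = ∑ n ∈ Finset.range N, Real.log (n + 1) := by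
      intro N
      induction N with
      | zero => simp
      | succ k ih =>
        rw [Finset.sum_range_succ, ← ih, Nat.factorial_succ, Nat.cast_mul,
          Real.log_mul (by positivity) (by positivity)]
        push_cast
        ring
    have htel : ∑ n ∈ Finset.range N, (Real.log ((n : ℝ) + 1 + 1) - Real.log (n + 1)) =
        Real.log (N + 1) := by
      have := Finset.sum_range_sub (fun n : ℕ => Real.log ((n : ℝ) + 1)) N
      simpa using this
    rw [Finset.sum_add_distrib, Finset.sum_sub_distrib, ← Finset.mul_sum, htel, ← hfac,
      Real.BohrMollerup.logGammaSeq, Finset.sum_range_succ]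
    simp_rw [add_comm x]
    ring
  have h3 : Filter.Tendsto (fun N : ℕ => Real.log ((N : ℝ) + x) - Real.log N) Filter.atTop
      (nhds 0) := (Real.tendsto_log_comp_add_sub_log x).comp tendsto_natCast_atTop_atTop
  have h4 := (h2.add (Real.tendsto_log_nat_add_one_sub_log.const_mul (x - 1))).add h3
  rw [mul_zero, add_zero, add_zero] at h4
  have h5 := tendsto_nhds_unique (h1.congr hsum) h4
  rw [logGammaSeries, h5, Real.exp_log (Real.Gamma_pos_of_pos hx)]

/-! ### The case `0 < q < 1` -/

theorem hasDerivAt_const_rpow {q : ℝ} (hq : 0 < q) (x : ℝ) :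
    HasDerivAt (fun x => q ^ x) (q ^ x * Real.log q) x := by
  simpa [mul_comm] using (hasDerivAt_id x).const_rpow hq

/-- The derivative of `x ↦ log (1 - q ^ x)`. -/
noncomputable def qLogSlope (q x : ℝ) : ℝ := -Real.log q * q ^ x / (1 - q ^ x)

theorem qLogSlope_curvature_eq {q x : ℝ} (hq0 : 0 < q) (hq1 : q < 1) (hx : 0 < x) :
    qLogSlope q x * (qLogSlope q x + -Real.log q) =
      Real.log q ^ 2 * q ^ x / (1 - q ^ x) ^ 2 := by
  have h : 1 - q ^ x ≠ 0 := by linarith [Real.rpow_lt_one hq0.le hq1 hx]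
  rw [qLogSlope]
  field_simp
  ring

theorem qLogSlope_curvature_le {q ε x : ℝ} (hq0 : 0 < q) (hq1 : q < 1) (hε : 0 < ε) (hx : ε ≤ x)
    (n : ℕ) : qLogSlope q (n + x) * (qLogSlope q (n + x) + -Real.log q) ≤
      Real.log q ^ 2 / (1 - q ^ ε) ^ 2 * q ^ x * q ^ n := by
  have hx0 : 0 < x := hε.trans_le hx
  have h := sub_pos.2 (Real.rpow_lt_one hq0.le hq1 hε)
  have h2 : q ^ (n + x) ≤ q ^ ε :=
    Real.rpow_le_rpow_of_exponent_ge hq0 hq1.le (by linarith [(Nat.cast_nonneg n : (0 : ℝ) ≤ n)])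
  rw [qLogSlope_curvature_eq hq0 hq1 (by positivity)]
  calc _ ≤ Real.log q ^ 2 * q ^ (n + x) / (1 - q ^ ε) ^ 2 := by gcongr
    _ = _ := by
      rw [Real.rpow_add hq0, Real.rpow_natCast]
      ring

theorem qLogSlope_le {q x : ℝ} (hq0 : 0 < q) (hq1 : q < 1) (hx : 1 ≤ x) (n : ℕ) :
    qLogSlope q (n + x) ≤ -Real.log q / (1 - q) * q ^ x * q ^ n := by
  have h := sub_pos.2 hq1
  have hL := neg_pos.2 (Real.log_neg hq0 hq1)
  have h2 : q ^ (n + x) ≤ q := by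
    simpa using Real.rpow_le_rpow_of_exponent_ge hq0 hq1.le
      (show 1 ≤ n + x by linarith [(Nat.cast_nonneg n : (0 : ℝ) ≤ n)])
  calc _ ≤ -Real.log q * q ^ (n + x) / (1 - q) := by
        rw [qLogSlope]
        gcongr
    _ = _ := by
      rw [Real.rpow_add hq0, Real.rpow_natCast]
      ring

theorem isQLog_log_one_sub_rpow {q : ℝ} (hq0 : 0 < q) (hq1 : q < 1) :
    IsQLog (-Real.log q) (fun x => Real.log (1 - q ^ x)) (qLogSlope q) where
  nonneg := (neg_pos.2 (Real.log_neg hq0 hq1)).le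
  hasDerivAt_log x hx := by
    have h := Real.rpow_lt_one hq0.le hq1 hx
    convert! ((hasDerivAt_const_rpow hq0 x).const_sub 1).log (by linarith) using 1
    rw [qLogSlope]
    ring
  hasDerivAt_slope x hx := by
    have h := Real.rpow_lt_one hq0.le hq1 hx
    have h' : 1 - q ^ x ≠ 0 := by linarith
    convert! ((hasDerivAt_const_rpow hq0 x).const_mul (-Real.log q)).div
      ((hasDerivAt_const_rpow hq0 x).const_sub 1) h' using 1
    rw [qLogSlope]
    field_simp
    ring
  pos x hx := by
    have h := sub_pos.2 (Real.rpow_lt_one hq0.le hq1 hx)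
    have := neg_pos.2 (Real.log_neg hq0 hq1)
    have := Real.rpow_pos_of_pos hq0 x
    rw [qLogSlope]
    positivity
  summable x hx := by
    refine .of_nonneg_of_le (fun n => ?_) (qLogSlope_curvature_le hq0 hq1 hx le_rfl)
      ((summable_geometric_of_lt_one hq0.le hq1).mul_left _)
    rw [qLogSlope_curvature_eq hq0 hq1 (by positivity)]
    positivity

/-- The inequality `t ≤ sinh t` at `t = -log q`. -/
theorem two_mul_neg_log_le {q : ℝ} (hq0 : 0 < q) (hq1 : q < 1) :
    2 * q * -Real.log q ≤ 1 - q ^ 2 := by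
  have h := Real.self_le_sinh_iff.2 (neg_pos.2 (Real.log_neg hq0 hq1)).le
  rw [Real.sinh_eq, neg_neg, Real.exp_neg, Real.exp_log hq0] at h
  have := mul_le_mul_of_nonneg_left h (show 0 ≤ 2 * q by positivity)
  have e : 2 * q * ((q⁻¹ - q) / 2) = 1 - q ^ 2 := by field_simp
  linarith

theorem qLogSlope_one_eq (q : ℝ) : qLogSlope q 1 = -Real.log q * q / (1 - q) := by
  rw [qLogSlope, Real.rpow_one]

theorem two_le_two_mul_qLogSlope_one_add {q : ℝ} (hq0 : 0 < q) (hq1 : q < 1) :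
    2 ≤ 2 * qLogSlope q 1 + -Real.log q := by
  have h := Real.le_log_one_add_of_nonneg (x := q⁻¹ - 1)
    (by linarith [(one_lt_inv₀ hq0).2 hq1])
  rw [add_sub_cancel, Real.log_inv] at h
  have e : 2 * (q⁻¹ - 1) / (q⁻¹ - 1 + 2) = 2 * (1 - q) / (1 + q) := by
    rw [show q⁻¹ - 1 + 2 = (1 + q) / q by field_simp; ring]
    field_simp
  rw [e, div_le_iff₀ (by positivity)] at h
  have h1 := sub_pos.2 hq1
  rw [qLogSlope_one_eq]
  have e2 : 2 * (-Real.log q * q / (1 - q)) + -Real.log q = -Real.log q * (1 + q) / (1 - q) := by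
    field_simp
    ring
  rw [e2, le_div_iff₀ h1]
  exact h

theorem qLogSlope_one_le_one {q : ℝ} (hq0 : 0 < q) (hq1 : q < 1) : qLogSlope q 1 ≤ 1 := by
  have h := Real.one_sub_inv_le_log_of_pos hq0
  rw [qLogSlope_one_eq, div_le_one (sub_pos.2 hq1)]
  have := mul_le_mul_of_nonneg_left h hq0.le
  rw [mul_sub, mul_inv_cancel₀ hq0.ne'] at this
  linarith

/-- With `y = q ^ (n + 1)` and `s = y (1 - q) / (1 - y)`, the increment of `log (1 - q ^ x)` is
`log (1 + s) ≥ s - s² / 2 ≥ s - s² / (2 q)`, and the bound `-log q ≤ (1 - q²) / (2 q)` turns this into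
the claim. -/
theorem qLogSlope_key_inequality {q : ℝ} (hq0 : 0 < q) (hq1 : q < 1) (n : ℕ) :
    0 ≤ qLogSlope q (n + 1) * (qLogSlope q (n + 1) + -Real.log q) +
      (2 * qLogSlope q 1 + -Real.log q) *
        (Real.log (1 - q ^ ((n : ℝ) + 1 + 1)) - Real.log (1 - q ^ ((n : ℝ) + 1)) -
          qLogSlope q (n + 1)) := by
  have hn : (0 : ℝ) ≤ n := n.cast_nonneg
  have hL := neg_pos.2 (Real.log_neg hq0 hq1)
  have hL2 := two_mul_neg_log_le hq0 hq1
  rw [qLogSlope_curvature_eq hq0 hq1 (by positivity), qLogSlope_one_eq, qLogSlope,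
    Real.rpow_add_one hq0.ne' ((n : ℝ) + 1), ← neg_sq (Real.log q)]
  have hy0 : 0 < q ^ ((n : ℝ) + 1) := by positivity
  have hyq : q ^ ((n : ℝ) + 1) ≤ q := by
    simpa using Real.rpow_le_rpow_of_exponent_ge hq0 hq1.le (show (1 : ℝ) ≤ n + 1 by linarith)
  generalize q ^ ((n : ℝ) + 1) = y at hy0 hyq ⊢
  generalize -Real.log q = a at hL hL2 ⊢
  have h1 : 0 < 1 - q := sub_pos.2 hq1
  have h2 : 0 < 1 - y := by linarith
  have h3 : 0 < 1 - y * q := by nlinarith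
  have hlog := sub_sq_div_two_le_log_one_add (s := y * (1 - q) / (1 - y)) (by positivity)
  rw [← Real.log_div h3.ne' h2.ne',
    show (1 - y * q) / (1 - y) = 1 + y * (1 - q) / (1 - y) by field_simp; ring]
  have hs : y * (1 - q) / (1 - y) - (y * (1 - q) / (1 - y)) ^ 2 / (2 * q) ≤
      y * (1 - q) / (1 - y) - (y * (1 - q) / (1 - y)) ^ 2 / 2 := by
    have : (y * (1 - q) / (1 - y)) ^ 2 / 2 ≤ (y * (1 - q) / (1 - y)) ^ 2 / (2 * q) := by
      gcongr
      linarith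
    linarith
  have hpos : 0 ≤ 2 * q - y - q * y := by nlinarith
  have h4 : a * y / (1 - y) - a * y * (1 - q) / ((1 + q) * (1 - y) ^ 2) ≤
      y * (1 - q) / (1 - y) - (y * (1 - q) / (1 - y)) ^ 2 / (2 * q) := by
    have e1 : a * y / (1 - y) - a * y * (1 - q) / ((1 + q) * (1 - y) ^ 2) =
        2 * q * a * (y * (2 * q - y - q * y) / (2 * q * (1 + q) * (1 - y) ^ 2)) := by
      field_simp
      ring
    have e2 : y * (1 - q) / (1 - y) - (y * (1 - q) / (1 - y)) ^ 2 / (2 * q) =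
        (1 - q ^ 2) * (y * (2 * q - y - q * y) / (2 * q * (1 + q) * (1 - y) ^ 2)) := by
      field_simp
      ring
    rw [e1, e2]
    gcongr
  have h5 := h4.trans (hs.trans hlog)
  have e3 : a ^ 2 * y / (1 - y) ^ 2 + (2 * (a * q / (1 - q)) + a) *
      (Real.log (1 + y * (1 - q) / (1 - y)) - a * y / (1 - y)) =
      a * (1 + q) / (1 - q) * (Real.log (1 + y * (1 - q) / (1 - y)) -
        (a * y / (1 - y) - a * y * (1 - q) / ((1 + q) * (1 - y) ^ 2))) := by
    field_simp
    ring
  rw [e3]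
  exact mul_nonneg (by positivity) (sub_nonneg.2 h5)

/-- The inequality `t ≤ 2 sinh (t / 2)` at `t = -x log q`. -/
theorem qLogSlope_curvature_le_one_div_sq {q x : ℝ} (hq0 : 0 < q) (hq1 : q < 1) (hx : 0 < x) :
    qLogSlope q x * (qLogSlope q x + -Real.log q) ≤ 1 / x ^ 2 := by
  have hz0 : 0 < q ^ (x / 2) := by positivity
  have hz1 : q ^ (x / 2) < 1 := Real.rpow_lt_one hq0.le hq1 (by positivity)
  have h := two_mul_neg_log_le hz0 hz1
  have e : q ^ x = (q ^ (x / 2)) ^ 2 := by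
    rw [← Real.rpow_natCast, ← Real.rpow_mul hq0.le]
    norm_num
  rw [Real.log_rpow hq0] at h
  rw [qLogSlope_curvature_eq hq0 hq1 hx, e]
  have hL := neg_pos.2 (Real.log_neg hq0 hq1)
  generalize q ^ (x / 2) = z at *
  have h1 : 0 < 1 - z ^ 2 := by nlinarith
  rw [div_le_div_iff₀ (by positivity) (by positivity), one_mul]
  have h2 : 0 ≤ z * x * -Real.log q := by positivity
  nlinarith [pow_le_pow_left₀ h2 (show z * x * -Real.log q ≤ 1 - z ^ 2 by linarith) 2]

theorem hasSum_log_increment {q : ℝ} (hq0 : 0 < q) (hq1 : q < 1) :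
    HasSum (fun n : ℕ => Real.log (1 - q ^ ((n : ℝ) + 1 + 1)) - Real.log (1 - q ^ ((n : ℝ) + 1)))
      (-Real.log (1 - q)) := by
  have hlt : ∀ n : ℕ, q ^ ((n : ℝ) + 1) < 1 := fun n => Real.rpow_lt_one hq0.le hq1 (by positivity)
  rw [hasSum_iff_tendsto_nat_of_nonneg]
  · have e : ∀ N : ℕ, ∑ n ∈ Finset.range N,
        (Real.log (1 - q ^ ((n : ℝ) + 1 + 1)) - Real.log (1 - q ^ ((n : ℝ) + 1))) =
        Real.log (1 - q ^ (N + 1)) - Real.log (1 - q) := by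
      intro N
      have := Finset.sum_range_sub (fun n : ℕ => Real.log (1 - q ^ ((n : ℝ) + 1))) N
      rw [← Real.rpow_natCast]
      simpa using this
    simp_rw [e]
    have h1 := (tendsto_pow_atTop_nhds_zero_of_lt_one hq0.le hq1).comp
      (Filter.tendsto_add_atTop_nat 1)
    have h2 := ((h1.const_sub 1).log (by norm_num)).sub_const (Real.log (1 - q))
    simpa using h2
  · intro n
    have h1 := hlt n
    refine sub_nonneg.2 (Real.log_le_log (by linarith) (sub_le_sub_left ?_ 1))
    exact Real.rpow_le_rpow_of_exponent_ge hq0 hq1.le (by linarith)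

theorem qGamma_eq_exp_logGammaSeries {q x : ℝ} (hq0 : 0 < q) (hq1 : q < 1) (hx : 0 < x) :
    qGamma q x = Real.exp (logGammaSeries (fun x => Real.log (1 - q ^ x)) x) := by
  have hs := (isQLog_log_one_sub_rpow hq0 hq1).summable_logGamma hx
  have hκ := (hasSum_log_increment hq0 hq1).mul_left (x - 1)
  have hp : ∀ y : ℝ, 0 < y → 0 < 1 - q ^ y := fun y hy =>
    sub_pos.2 (Real.rpow_lt_one hq0.le hq1 hy)
  have hd : HasSum (fun n : ℕ => Real.log ((1 - q ^ ((n : ℝ) + 1)) / (1 - q ^ ((n : ℝ) + x))))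
      (logGammaSeries (fun x => Real.log (1 - q ^ x)) x - (x - 1) * -Real.log (1 - q)) := by
    convert! hs.hasSum.sub hκ using 2 with n
    rw [Real.log_div (hp _ (by positivity)).ne' (hp _ (by positivity)).ne']
    ring
  have h1 := Real.rexp_tsum_eq_tprod (fun n : ℕ => div_pos (hp (n + 1) (by positivity))
    (hp (n + x) (by positivity))) hd.summable
  rw [qGamma, if_pos hq1, ← h1, hd.tsum_eq, Real.rpow_def_of_pos (sub_pos.2 hq1), ← Real.exp_add]
  ring_nf

/-! ### From logarithmic derivatives to the characterization -/

theorem qDigamma_eq {q : ℝ} {F ψ : ℝ → ℝ} (hF : ∀ x, 0 < x → qGamma q x = Real.exp (F x))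
    (hψ : ∀ x, 0 < x → HasDerivAt F (ψ x) x) {x : ℝ} (hx : 0 < x) : qDigamma q x = ψ x := by
  have e : qGamma q =ᶠ[nhds x] fun x => Real.exp (F x) := by
    filter_upwards [lt_mem_nhds hx] with y hy using hF y hy
  rw [qDigamma, e.deriv_eq, (hψ x hx).exp.deriv, hF x hx, mul_div_cancel_left₀ _ (Real.exp_ne_zero _)]

theorem deriv_qDigamma_eq {q : ℝ} {F ψ D : ℝ → ℝ}
    (hF : ∀ x, 0 < x → qGamma q x = Real.exp (F x))
    (hψ : ∀ x, 0 < x → HasDerivAt F (ψ x) x) (hD : ∀ x, 0 < x → HasDerivAt ψ (D x) x)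
    {x : ℝ} (hx : 0 < x) : deriv (qDigamma q) x = D x := by
  have e : qDigamma q =ᶠ[nhds x] ψ := by
    filter_upwards [lt_mem_nhds hx] with y hy using qDigamma_eq hF hψ hy
  rw [e.deriv_eq, (hD x hx).deriv]

/-- The conclusions for an abstract function `ψ` with derivative `D`, once `D + c ψ` is known to be
monotone for the critical `c = -D 1 / ψ 1`, at which it vanishes at `1`. -/
theorem ratio_characterization {ψ D : ℝ → ℝ} (hψ1 : ψ 1 < 0) (hD : ∀ x, 1 ≤ x → 0 ≤ D x)
    (h2 : 0 ≤ D 1 + 2 * ψ 1)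
    (hmono : MonotoneOn (fun x => D x + -(D 1 / ψ 1) * ψ x) (Set.Ici 1))
    (hneg : ∀ a < 0, ∃ x, 1 ≤ x ∧ D x + a * ψ x < 0) :
    ψ 1 < 0 ∧ 2 ≤ -(D 1 / ψ 1) ∧
    (∀ a : ℝ, (∀ x : ℝ, 1 ≤ x → 0 ≤ D x + a * ψ x) ↔ 0 ≤ a ∧ a ≤ -(D 1 / ψ 1)) ∧
    (∀ x : ℝ, 1 ≤ x → 0 ≤ D x + ψ x) ∧
    (∀ x : ℝ, 1 ≤ x → 0 ≤ D x + 2 * ψ x) ∧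
    (∀ a : ℝ, 0 ≤ a → a ≤ -(D 1 / ψ 1) → ∀ x : ℝ, 1 ≤ x → 0 ≤ x * D x + a * ψ x) ∧
    (∀ a : ℝ, (∀ x : ℝ, 1 ≤ x → 0 ≤ x * D x + a * ψ x) → a ≤ -(D 1 / ψ 1)) := by
  have hle : ∀ a, 0 ≤ D 1 + a * ψ 1 → a ≤ -(D 1 / ψ 1) := by
    intro a ha
    rw [← div_neg, le_div_iff₀ (neg_pos.2 hψ1)]
    linarith
  have hc : 2 ≤ -(D 1 / ψ 1) := hle 2 h2
  have hzero : D 1 + -(D 1 / ψ 1) * ψ 1 = 0 := by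
    field_simp [hψ1.ne]
    ring
  have main : ∀ a : ℝ, 0 ≤ a → a ≤ -(D 1 / ψ 1) → ∀ x : ℝ, 1 ≤ x → 0 ≤ D x + a * ψ x := by
    intro a ha hac x hx
    have h1 : D 1 + -(D 1 / ψ 1) * ψ 1 ≤ D x + -(D 1 / ψ 1) * ψ x :=
      hmono Set.self_mem_Ici hx hx
    rw [hzero] at h1
    have h0 := hD x hx
    rcases le_total 0 (ψ x) with h | h
    · positivity
    · linarith [mul_le_mul_of_nonpos_right hac h]
  refine ⟨hψ1, hc, fun a => ⟨fun h => ⟨?_, hle a (h 1 le_rfl)⟩, fun h => main a h.1 h.2⟩,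
    fun x hx => ?_, main 2 zero_le_two hc, fun a ha hac x hx => ?_, fun a h => ?_⟩
  · by_contra! ha
    obtain ⟨x, hx, hlt⟩ := hneg a ha
    exact hlt.not_ge (h x hx)
  · simpa using main 1 zero_le_one (by linarith) x hx
  · exact (main a ha hac x hx).trans (by linarith [le_mul_of_one_le_left (hD x hx) hx])
  · exact hle a (by simpa using h 1 le_rfl)

/-- The conclusions for `q ≤ 1`. The exclusion of negative `a` in the weighted form implies that in
the unweighted form. -/
theorem IsQLog.characterization {q L : ℝ} {ℓ r : ℝ → ℝ} (h : IsQLog L ℓ r)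
    (hΓ : ∀ x, 0 < x → qGamma q x = Real.exp (logGammaSeries ℓ x))
    (hκ : ∀ n : ℕ, 0 ≤ r (n + 1) * (r (n + 1) + L) +
      (2 * r 1 + L) * (ℓ (n + 1 + 1) - ℓ (n + 1) - r (n + 1)))
    (hM : 2 ≤ 2 * r 1 + L)
    (hneg : ∀ a < 0, ∃ x, 1 ≤ x ∧ x * trigammaSeries L r x + a * digammaSeries ℓ r x < 0) :
    qDigamma q 1 < 0 ∧
    2 ≤ -(deriv (qDigamma q) 1 / qDigamma q 1) ∧
    (∀ a : ℝ, (∀ x : ℝ, 1 ≤ x → 0 ≤ deriv (qDigamma q) x + a * qDigamma q x) ↔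
      0 ≤ a ∧ a ≤ -(deriv (qDigamma q) 1 / qDigamma q 1)) ∧
    (∀ x : ℝ, 1 ≤ x → 0 ≤ deriv (qDigamma q) x + qDigamma q x) ∧
    (∀ x : ℝ, 1 ≤ x → 0 ≤ deriv (qDigamma q) x + 2 * qDigamma q x) ∧
    (∀ a : ℝ, 0 ≤ a → a ≤ -(deriv (qDigamma q) 1 / qDigamma q 1) →
      ∀ x : ℝ, 1 ≤ x → 0 ≤ x * deriv (qDigamma q) x + a * qDigamma q x) ∧
    (∀ a : ℝ, (∀ x : ℝ, 1 ≤ x → 0 ≤ x * deriv (qDigamma q) x + a * qDigamma q x) →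
      a ≤ -(deriv (qDigamma q) 1 / qDigamma q 1)) ∧
    (q ≤ 1 → ∀ a : ℝ,
      (∀ x : ℝ, 1 ≤ x → 0 ≤ x * deriv (qDigamma q) x + a * qDigamma q x) ↔
        0 ≤ a ∧ a ≤ -(deriv (qDigamma q) 1 / qDigamma q 1)) := by
  have hdig : ∀ x, 0 < x → qDigamma q x = digammaSeries ℓ r x := fun x hx =>
    qDigamma_eq hΓ (fun x hx => h.hasDerivAt_logGammaSeries hx) hx
  have htri : ∀ x, 0 < x → deriv (qDigamma q) x = trigammaSeries L r x := fun x hx =>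
    deriv_qDigamma_eq hΓ (fun x hx => h.hasDerivAt_logGammaSeries hx)
      (fun x hx => h.hasDerivAt_digammaSeries hx) hx
  have hψ1 : qDigamma q 1 < 0 := hdig 1 one_pos ▸ h.digammaSeries_one_neg
  have hD : ∀ x, 1 ≤ x → 0 ≤ deriv (qDigamma q) x := fun x hx => by
    rw [htri x (by linarith)]
    exact h.trigammaSeries_nonneg (by linarith)
  have hB := h.trigamma_add_digamma_one_nonneg hκ
  rw [← hdig 1 one_pos, ← htri 1 one_pos] at hB
  have hMc : 2 * r 1 + L ≤ -(deriv (qDigamma q) 1 / qDigamma q 1) := by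
    rw [← div_neg, le_div_iff₀ (neg_pos.2 hψ1)]
    linarith
  have hneg' : ∀ a < 0, ∃ x, 1 ≤ x ∧ x * deriv (qDigamma q) x + a * qDigamma q x < 0 := by
    intro a ha
    obtain ⟨x, hx, hlt⟩ := hneg a ha
    exact ⟨x, hx, by rwa [hdig x (by linarith), htri x (by linarith)]⟩
  obtain ⟨c1, c2, c3, c4, c5, c6, c7⟩ := ratio_characterization hψ1 hD
    (hB.trans (by linarith [mul_le_mul_of_nonpos_right hM hψ1.le]))
    ((h.monotoneOn_trigamma_add hMc).congr fun x hx => by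
      have hx' : (1 : ℝ) ≤ x := hx
      simp only [hdig x (by linarith), htri x (by linarith)])
    (fun a ha => by
      obtain ⟨x, hx, hlt⟩ := hneg' a ha
      exact ⟨x, hx, by linarith [le_mul_of_one_le_left (hD x hx) hx]⟩)
  refine ⟨c1, c2, c3, c4, c5, c6, c7, fun _ a => ⟨fun hx => ⟨?_, c7 a hx⟩, fun ha => c6 a ha.1 ha.2⟩⟩
  by_contra! ha
  obtain ⟨x, hx1, hlt⟩ := hneg' a ha
  exact hlt.not_ge (hx x hx1)

/-! ### Behaviour at infinity for `q ≤ 1` -/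

/-- As `x → ∞` through the integers, `x ψ_q'(x)` tends to `0` and `ψ_q(x)` to `-log (1 - q) > 0`,
both at a geometric rate. -/
theorem exists_weighted_neg_of_lt_one {q : ℝ} (hq0 : 0 < q) (hq1 : q < 1) {a : ℝ} (ha : a < 0) :
    ∃ x, 1 ≤ x ∧ x * trigammaSeries (-Real.log q) (qLogSlope q) x +
      a * digammaSeries (fun x => Real.log (1 - q ^ x)) (qLogSlope q) x < 0 := by
  have h := isQLog_log_one_sub_rpow hq0 hq1
  have hg := hasSum_geometric_of_lt_one hq0.le hq1
  obtain ⟨C, hC⟩ : ∃ C, ∀ x : ℝ, 1 ≤ x →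
      trigammaSeries (-Real.log q) (qLogSlope q) x ≤ C * q ^ x := by
    refine ⟨Real.log q ^ 2 / (1 - q ^ (1 : ℝ)) ^ 2 * (1 - q)⁻¹, fun x hx => ?_⟩
    refine (hasSum_le (fun n => qLogSlope_curvature_le hq0 hq1 one_pos hx n)
      (h.summable x (by linarith)).hasSum (hg.mul_left _)).trans_eq ?_
    ring
  obtain ⟨B, hB⟩ : ∃ B, ∀ x : ℝ, 1 ≤ x → -Real.log (1 - q) - B * q ^ x ≤
      digammaSeries (fun x => Real.log (1 - q ^ x)) (qLogSlope q) x := by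
    refine ⟨-Real.log q / (1 - q) * (1 - q)⁻¹, fun x hx => ?_⟩
    refine le_trans (le_of_eq ?_) (hasSum_le (fun n => sub_le_sub_left (qLogSlope_le hq0 hq1 hx n) _)
      ((hasSum_log_increment hq0 hq1).sub (hg.mul_left _)) (h.summable_digamma (by linarith)).hasSum)
    ring
  have h1 := (tendsto_self_mul_const_pow_of_lt_one hq0.le hq1).const_mul C
  have h2 := (((tendsto_pow_atTop_nhds_zero_of_lt_one hq0.le hq1).const_mul B).const_sub
    (-Real.log (1 - q))).const_mul a
  have h3 := h1.add h2
  rw [mul_zero, mul_zero, zero_add, sub_zero] at h3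
  have hK : 0 < -Real.log (1 - q) := neg_pos.2 (Real.log_neg (by linarith) (by linarith))
  obtain ⟨N, hN, hN1⟩ := ((h3.eventually_lt_const (mul_neg_of_neg_of_pos ha hK)).and
    (Filter.eventually_ge_atTop 1)).exists
  have hN1' : (1 : ℝ) ≤ N := by exact_mod_cast hN1
  refine ⟨N, hN1', lt_of_le_of_lt ?_ hN⟩
  have e1 := mul_le_mul_of_nonneg_left (hC N hN1') (by linarith : (0 : ℝ) ≤ N)
  have e2 := mul_le_mul_of_nonpos_left (hB N hN1') ha.le
  rw [Real.rpow_natCast] at e1 e2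
  linarith

theorem trigammaSeries_one_div_le {x : ℝ} (hx : 1 < x) :
    trigammaSeries 0 (fun x => 1 / x) x ≤ 1 / (x - 1) := by
  have hx1 := sub_pos.2 hx
  refine Real.tsum_le_of_sum_range_le (fun n => isQLog_log.curvature_nonneg (by positivity)) fun N => ?_
  have key : ∑ n ∈ Finset.range N, 1 / ((n : ℝ) + x) * (1 / ((n : ℝ) + x) + 0) ≤
      1 / (x - 1) - 1 / (N + (x - 1)) := by
    induction N with
    | zero => simp
    | succ N ih =>
      rw [Finset.sum_range_succ]
      have hN : (0 : ℝ) < N + (x - 1) := by positivity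
      have e : 1 / ((N : ℝ) + x) * (1 / ((N : ℝ) + x) + 0) ≤
          1 / (N + (x - 1)) - 1 / ((N + 1 : ℕ) + (x - 1)) := by
        push_cast
        rw [show (N : ℝ) + 1 + (x - 1) = N + x by ring, show (N : ℝ) + (x - 1) = N + x - 1 by ring,
          add_zero]
        rw [show (N : ℝ) + (x - 1) = N + x - 1 by ring] at hN
        generalize (N : ℝ) + x = y at hN ⊢
        have hy : 0 < y := by linarith
        rw [div_sub_div _ _ hN.ne' hy.ne', div_mul_div_comm, div_le_div_iff₀ (by positivity)
          (by positivity)]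
        nlinarith
      linarith
  have : 0 ≤ 1 / ((N : ℝ) + (x - 1)) := by positivity
  linarith

/-- At the integers `ψ` grows like the harmonic numbers, while `x ψ'(x)` stays bounded. -/
theorem exists_weighted_neg_one {a : ℝ} (ha : a < 0) :
    ∃ x, 1 ≤ x ∧ x * trigammaSeries 0 (fun x => 1 / x) x +
      a * digammaSeries Real.log (fun x => 1 / x) x < 0 := by
  have hdig : ∀ m : ℕ, digammaSeries Real.log (fun x => 1 / x) (m + 1) =
      -Real.eulerMascheroniConstant + harmonic m := by
    intro m
    have hm : (0 : ℝ) < m + 1 := by positivity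
    have e : Real.Gamma =ᶠ[nhds ((m : ℝ) + 1)]
        fun x => Real.exp (logGammaSeries Real.log x) := by
      filter_upwards [lt_mem_nhds hm] with y hy using Gamma_eq_exp_logGammaSeries hy
    have h1 := Real.deriv_Gamma_nat m
    rw [e.deriv_eq, (isQLog_log.hasDerivAt_logGammaSeries hm).exp.deriv,
      ← Gamma_eq_exp_logGammaSeries hm, Real.Gamma_nat_eq_factorial] at h1
    exact mul_left_cancel₀ (by positivity) h1
  have hlim : Filter.Tendsto (fun m : ℕ => Real.log ((m + 1 : ℕ) : ℝ)) Filter.atTop Filter.atTop :=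
    Real.tendsto_log_atTop.comp (tendsto_natCast_atTop_atTop.comp (Filter.tendsto_add_atTop_nat 1))
  obtain ⟨m, hm, hm1⟩ := ((hlim.eventually_gt_atTop
    (Real.eulerMascheroniConstant + 2 / -a)).and (Filter.eventually_ge_atTop 1)).exists
  have hm1' : (1 : ℝ) ≤ m := by exact_mod_cast hm1
  refine ⟨m + 1, by linarith, ?_⟩
  have h1 := trigammaSeries_one_div_le (x := (m : ℝ) + 1) (by linarith)
  rw [add_sub_cancel_right] at h1
  have h2 : ((m : ℝ) + 1) * trigammaSeries 0 (fun x => 1 / x) (m + 1) ≤ 2 := by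
    refine (mul_le_mul_of_nonneg_left h1 (by positivity)).trans ?_
    rw [mul_one_div, div_le_iff₀ (by positivity)]
    linarith
  have h3 : 2 / -a < -Real.eulerMascheroniConstant + harmonic m := by
    linarith [log_add_one_le_harmonic m]
  rw [div_lt_iff₀ (neg_pos.2 ha)] at h3
  rw [hdig m]
  linarith

/-! ### The case `q > 1` -/

/-- The functional relation `Γ_q(x) = q ^ ((x - 1) (x - 2) / 2) Γ_{1/q}(x)`. -/
theorem qGamma_eq_mul_qGamma_inv {q : ℝ} (hq : 1 < q) (x : ℝ) :
    qGamma q x = Real.exp ((x - 1) * (x - 2) / 2 * Real.log q) * qGamma q⁻¹ x := by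
  have hq0 : 0 < q := one_pos.trans hq
  have hp : q⁻¹ < 1 := inv_lt_one_of_one_lt₀ hq
  have e : (1 - q⁻¹) ^ (1 - x) = (q - 1) ^ (1 - x) * q ^ (x - 1) := by
    rw [show 1 - q⁻¹ = (q - 1) * q⁻¹ by field_simp,
      Real.mul_rpow (by linarith) (by positivity), Real.inv_rpow hq0.le, ← Real.rpow_neg hq0.le,
      neg_sub]
  rw [qGamma, if_neg hq.not_gt, if_neg hq.ne', qGamma, if_pos hp, e]
  have e2 : q ^ (x * (x - 1) / 2) = Real.exp ((x - 1) * (x - 2) / 2 * Real.log q) * q ^ (x - 1) := by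
    rw [Real.rpow_def_of_pos hq0, Real.rpow_def_of_pos hq0, ← Real.exp_add]
    ring_nf
  simp_rw [e2, Real.inv_rpow hq0.le, ← Real.rpow_neg hq0.le]
  ring

theorem trigammaSeries_qLogSlope_le_two {q x : ℝ} (hq0 : 0 < q) (hq1 : q < 1) (hx : 1 ≤ x) :
    trigammaSeries (-Real.log q) (qLogSlope q) x ≤ 2 := by
  have h := isQLog_log_one_sub_rpow hq0 hq1
  have hz : HasSum (fun n : ℕ => (1 : ℝ) / ((n : ℝ) + 1) ^ 2) (Real.pi ^ 2 / 6) := by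
    have := (hasSum_nat_add_iff' 1).2 hasSum_zeta_two
    simpa using this
  refine (h.trigammaSeries_le one_pos hx).trans ((hasSum_le (fun n =>
    qLogSlope_curvature_le_one_div_sq hq0 hq1 (by positivity))
    (h.summable 1 one_pos).hasSum hz).trans ?_)
  nlinarith [Real.pi_lt_d2, Real.pi_pos]

/-- For `q > 1` and `p = 1 / q` one has `ψ_q(x) = (x - 3/2) log q + ψ_p(x)`. The extra term makes
`ψ_q' + c ψ_q` monotone already for `c ≥ 2`: it is, up to a constant, the sum of
`ψ_p' + (L + 2) ψ_p` and `c L x + (c - 2 - L) ψ_p`, where `L = log q` and `ψ_p' ≤ 2`. -/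
theorem monotoneOn_of_one_lt {q c : ℝ} (hq : 1 < q) (hc : 2 ≤ c) :
    MonotoneOn (fun x => Real.log q + trigammaSeries (-Real.log q⁻¹) (qLogSlope q⁻¹) x +
      c * ((x - 3 / 2) * Real.log q +
        digammaSeries (fun x => Real.log (1 - q⁻¹ ^ x)) (qLogSlope q⁻¹) x)) (Set.Ici 1) := by
  have hp0 : 0 < q⁻¹ := by positivity
  have hp1 : q⁻¹ < 1 := inv_lt_one_of_one_lt₀ hq
  have h := isQLog_log_one_sub_rpow hp0 hp1
  have hL : 0 < Real.log q := Real.log_pos hq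
  have hr := qLogSlope_one_le_one hp0 hp1
  have hm1 := h.monotoneOn_trigamma_add (c := Real.log q + 2)
    (by rw [Real.log_inv] at *; linarith)
  have hm2 : MonotoneOn (fun x => c * Real.log q * x + (c - 2 - Real.log q) *
      digammaSeries (fun x => Real.log (1 - q⁻¹ ^ x)) (qLogSlope q⁻¹) x) (Set.Ici 1) := by
    have hd : ∀ x : ℝ, 1 ≤ x → HasDerivAt (fun x => c * Real.log q * x + (c - 2 - Real.log q) *
        digammaSeries (fun x => Real.log (1 - q⁻¹ ^ x)) (qLogSlope q⁻¹) x)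
        (c * Real.log q * 1 + (c - 2 - Real.log q) *
          trigammaSeries (-Real.log q⁻¹) (qLogSlope q⁻¹) x) x := fun x hx =>
      ((hasDerivAt_id x).const_mul _).add
        ((h.hasDerivAt_digammaSeries (by linarith)).const_mul _)
    refine monotoneOn_of_deriv_nonneg (convex_Ici 1)
      (fun x hx => (hd x hx).continuousAt.continuousWithinAt)
      (fun x hx => (hd x (interior_subset hx)).differentiableAt.differentiableWithinAt)
      fun x hx => ?_
    have hx1 : (1 : ℝ) ≤ x := interior_subset hx
    rw [(hd x hx1).deriv]
    have t0 := h.trigammaSeries_nonneg (x := x) (by linarith)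
    have t2 := trigammaSeries_qLogSlope_le_two hp0 hp1 hx1
    generalize trigammaSeries (-Real.log q⁻¹) (qLogSlope q⁻¹) x = t at t0 t2 ⊢
    nlinarith [mul_nonneg (sub_nonneg.2 hc) t0, mul_nonneg hL.le (sub_nonneg.2 t2),
      mul_nonneg hL.le (sub_nonneg.2 hc)]
  refine ((hm1.add hm2).add_const (Real.log q - c * (3 / 2) * Real.log q)).congr fun x _ => ?_
  ring_nf

theorem characterization_of_one_lt {q : ℝ} (hq : 1 < q) :
    qDigamma q 1 < 0 ∧
    2 ≤ -(deriv (qDigamma q) 1 / qDigamma q 1) ∧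
    (∀ a : ℝ, (∀ x : ℝ, 1 ≤ x → 0 ≤ deriv (qDigamma q) x + a * qDigamma q x) ↔
      0 ≤ a ∧ a ≤ -(deriv (qDigamma q) 1 / qDigamma q 1)) ∧
    (∀ x : ℝ, 1 ≤ x → 0 ≤ deriv (qDigamma q) x + qDigamma q x) ∧
    (∀ x : ℝ, 1 ≤ x → 0 ≤ deriv (qDigamma q) x + 2 * qDigamma q x) ∧
    (∀ a : ℝ, 0 ≤ a → a ≤ -(deriv (qDigamma q) 1 / qDigamma q 1) →
      ∀ x : ℝ, 1 ≤ x → 0 ≤ x * deriv (qDigamma q) x + a * qDigamma q x) ∧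
    (∀ a : ℝ, (∀ x : ℝ, 1 ≤ x → 0 ≤ x * deriv (qDigamma q) x + a * qDigamma q x) →
      a ≤ -(deriv (qDigamma q) 1 / qDigamma q 1)) := by
  have hp0 : 0 < q⁻¹ := by positivity
  have hp1 : q⁻¹ < 1 := inv_lt_one_of_one_lt₀ hq
  have h := isQLog_log_one_sub_rpow hp0 hp1
  have hL : 0 < Real.log q := Real.log_pos hq
  set ψ := digammaSeries (fun x => Real.log (1 - q⁻¹ ^ x)) (qLogSlope q⁻¹) with hψ
  set D := trigammaSeries (-Real.log q⁻¹) (qLogSlope q⁻¹) with hDdef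
  have hΓ : ∀ x, 0 < x → qGamma q x = Real.exp ((x - 1) * (x - 2) / 2 * Real.log q +
      logGammaSeries (fun x => Real.log (1 - q⁻¹ ^ x)) x) := fun x hx => by
    rw [qGamma_eq_mul_qGamma_inv hq, qGamma_eq_exp_logGammaSeries hp0 hp1 hx, Real.exp_add]
  have hΓ' : ∀ x, 0 < x → HasDerivAt (fun x => (x - 1) * (x - 2) / 2 * Real.log q +
      logGammaSeries (fun x => Real.log (1 - q⁻¹ ^ x)) x) ((x - 3 / 2) * Real.log q + ψ x) x := by
    intro x hx
    have e := ((((hasDerivAt_id x).sub_const 1).mul ((hasDerivAt_id x).sub_const 2)).div_const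
      2).mul_const (Real.log q)
    convert! e.add (h.hasDerivAt_logGammaSeries hx) using 1
    simp only [id]
    ring
  have hψ' : ∀ x, 0 < x → HasDerivAt (fun x => (x - 3 / 2) * Real.log q + ψ x)
      (Real.log q + D x) x := by
    intro x hx
    convert! (((hasDerivAt_id x).sub_const (3 / 2)).mul_const (Real.log q)).add
      (h.hasDerivAt_digammaSeries hx) using 1
    ring
  have hdig : ∀ x, 0 < x → qDigamma q x = (x - 3 / 2) * Real.log q + ψ x := fun x hx =>
    qDigamma_eq hΓ hΓ' hx
  have htri : ∀ x, 0 < x → deriv (qDigamma q) x = Real.log q + D x := fun x hx =>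
    deriv_qDigamma_eq hΓ hΓ' hψ' hx
  have hψ1 : ψ 1 < 0 := h.digammaSeries_one_neg
  have hq1 : qDigamma q 1 < 0 := by
    rw [hdig 1 one_pos]
    linarith
  have h2 : 0 ≤ deriv (qDigamma q) 1 + 2 * qDigamma q 1 := by
    have hB := h.trigamma_add_digamma_one_nonneg (qLogSlope_key_inequality hp0 hp1)
    have hM := mul_le_mul_of_nonpos_right (two_le_two_mul_qLogSlope_one_add hp0 hp1) hψ1.le
    rw [hdig 1 one_pos, htri 1 one_pos]
    linarith
  refine ratio_characterization hq1 (fun x hx => ?_) h2 ?_ fun a ha => ?_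
  · rw [htri x (by linarith)]
    linarith [h.trigammaSeries_nonneg (x := x) (by linarith)]
  · have hc : 2 ≤ -(deriv (qDigamma q) 1 / qDigamma q 1) := by
      rw [← div_neg, le_div_iff₀ (neg_pos.2 hq1)]
      linarith
    refine (monotoneOn_of_one_lt hq hc).congr fun x hx => ?_
    have hx' : (1 : ℝ) ≤ x := hx
    simp only [hdig x (by linarith), htri x (by linarith), hψ, hDdef]
  · -- `ψ_q'` is at most `log q + 2` on `[1, ∞)`, while `ψ_q` grows at least linearly.
    obtain ⟨x, hx⟩ := exists_gt (max 1 (3 / 2 + ((Real.log q + 2) / -a - ψ 1) / Real.log q))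
    rw [max_lt_iff] at hx
    have hx0 : 0 < x := one_pos.trans hx.1
    refine ⟨x, hx.1.le, ?_⟩
    rw [hdig x hx0, htri x hx0]
    have hD2 : D x ≤ 2 := trigammaSeries_qLogSlope_le_two hp0 hp1 hx.1.le
    have hmono : ψ 1 ≤ ψ x := h.digammaSeries_monotoneOn (Set.mem_Ioi.2 one_pos) hx0 hx.1.le
    have hlin := hx.2
    rw [← lt_sub_iff_add_lt', div_lt_iff₀ hL, sub_lt_iff_lt_add, div_lt_iff₀ (neg_pos.2 ha)] at hlin
    nlinarith [mul_le_mul_of_nonpos_left hmono ha.le]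

/-! ### All `q > 0` -/

theorem mainTheorem11 (q : ℝ) (hq : 0 < q) :
    -- the denominator is negative, and the bound on `a` is at least `2`
    qDigamma q 1 < 0 ∧
    2 ≤ -(deriv (qDigamma q) 1 / qDigamma q 1) ∧
    -- the characterization
    (∀ a : ℝ, (∀ x : ℝ, 1 ≤ x → 0 ≤ deriv (qDigamma q) x + a * qDigamma q x) ↔
      0 ≤ a ∧ a ≤ -(deriv (qDigamma q) 1 / qDigamma q 1)) ∧
    -- the special cases `a = 1` and `a = 2`
    (∀ x : ℝ, 1 ≤ x → 0 ≤ deriv (qDigamma q) x + qDigamma q x) ∧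
    (∀ x : ℝ, 1 ≤ x → 0 ≤ deriv (qDigamma q) x + 2 * qDigamma q x) ∧
    -- the weighted form, with the factor `x`
    (∀ a : ℝ, 0 ≤ a → a ≤ -(deriv (qDigamma q) 1 / qDigamma q 1) →
      ∀ x : ℝ, 1 ≤ x → 0 ≤ x * deriv (qDigamma q) x + a * qDigamma q x) ∧
    (∀ a : ℝ, (∀ x : ℝ, 1 ≤ x → 0 ≤ x * deriv (qDigamma q) x + a * qDigamma q x) →
      a ≤ -(deriv (qDigamma q) 1 / qDigamma q 1)) ∧
    (q ≤ 1 → ∀ a : ℝ,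
      (∀ x : ℝ, 1 ≤ x → 0 ≤ x * deriv (qDigamma q) x + a * qDigamma q x) ↔
        0 ≤ a ∧ a ≤ -(deriv (qDigamma q) 1 / qDigamma q 1)) := by
  rcases lt_trichotomy q 1 with h | rfl | h
  · exact (isQLog_log_one_sub_rpow hq h).characterization
      (fun x hx => qGamma_eq_exp_logGammaSeries hq h hx) (qLogSlope_key_inequality hq h)
      (two_le_two_mul_qLogSlope_one_add hq h) fun a ha => exists_weighted_neg_of_lt_one hq h ha
  · refine isQLog_log.characterization (fun x hx => ?_) log_key_inequality (by norm_num)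
      fun a ha => exists_weighted_neg_one ha
    rw [qGamma, if_neg (lt_irrefl 1), if_pos rfl, Gamma_eq_exp_logGammaSeries hx]
  · obtain ⟨c1, c2, c3, c4, c5, c6, c7⟩ := characterization_of_one_lt h
    exact ⟨c1, c2, c3, c4, c5, c6, c7, fun hq1 => absurd h hq1.not_gt⟩
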